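/- Let $d\ge 1$, let $\mathbb X\subseteq\mathbb R^d$ be measurable, and let $(\mathbb T,d\theta)$ be a parameter space (a measurable space with a reference measure, e.g. a measurable subset of $\mathbb R^p$ with Lebesgue measure). Let $f(\cdot\,|\,\theta)$, $\theta\in\mathbb T$, be PDFs on $\mathbb X$ with respect to Lebesgue measure, jointly measurable in $(x,\theta)$, let $P_\theta$ be the distribution with PDF $f(\cdot\,|\,\theta)$ and $\varphi(t;\theta)$ its characteristic function, and assume $\int\|x\|^2\,dP_\theta(x)<\infty$ for every $\theta\in\mathbb T$. Let $\pi$ be a prior PDF on $\mathbb T$, and let $w(r,\epsilon)$ be a weight function: for every $\epsilon>0$ it is non-negative, bounded and non-increasing in $r\in[0,\infty)$. Write $C(w(\cdot,\epsilon))$ for the set of points of $[0,\infty)$ at which $w(\cdot,\epsilon)$, as a function on $[0,\infty)$, is continuous. For samples $\mathbf x_n=(x_1,\dots,x_n)$, $\mathbf y_m=(y_1,\dots,y_m)$ put $$\mathcal V_{\delta_1}(\mathbf x_n,\mathbf y_m)=\frac{2}{mn}\sum_{i=1}^n\sum_{j=1}^m\|x_i-y_j\|-\frac1{n^2}\sum_{i,j=1}^n\|x_i-x_j\|-\frac1{m^2}\sum_{i,j=1}^m\|y_i-y_j\|,$$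 $$L_{m,\epsilon}(\mathbf x_n|\theta)=\int_{\mathbb X^m}w\big(\mathcal V_{\delta_1}(\mathbf x_n,\mathbf y_m),\epsilon\big)\prod_{i=1}^m f(y_i|\theta)\,d\mathbf y_m,\qquad \pi_{m,\epsilon}(\theta|\mathbf x_n)=\frac{\pi(\theta)L_{m,\epsilon}(\mathbf x_n|\theta)}{\int_{\mathbb T}\pi(\theta')L_{m,\epsilon}(\mathbf x_n|\theta')\,d\theta'},$$ $$\mathcal D_\infty(\theta_0,\theta)=\frac{\Gamma(\frac{d+1}2)}{\pi^{(d+1)/2}}\int_{\mathbb R^d}\frac{|\varphi(t;\theta_0)-\varphi(t;\theta)|^2}{\|t\|^{d+1}}\,dt .$$ (In the last formula $\pi$ is the number.) Let $\theta_0\in\mathbb T$, let $X_1,X_2,\dots$ be IID with distribution $P_{\theta_0}$, $\mathbf X_n=(X_1,\dots,X_n)$, and let $m=m(n)\to\infty$ as $n\to\infty$. Then: 1. For every $\theta\in\mathbb T$, if $Y_1,Y_2,\dots$ are IID with distribution $P_\theta$ and independent of $(X_i)_i$, and $\mathbf Y_m=(Y_1,\dots,Y_m)$, then $\mathcal V_{\delta_1}(\mathbf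 X_n,\mathbf Y_m)\to\mathcal D_\infty(\theta_0,\theta)$ almost surely as $n\to\infty$. 2. Let $\epsilon>0$ be such that $\mathcal D_\infty(\theta_0,\theta)\in C(w(\cdot,\epsilon))$ for almost every $\theta$ with $\pi(\theta)>0$, and $\int_{\mathbb T}\pi(\theta)w(\mathcal D_\infty(\theta_0,\theta),\epsilon)\,d\theta>0$. Then for every $\theta\in\mathbb T$ with $\mathcal D_\infty(\theta_0,\theta)\in C(w(\cdot,\epsilon))$, $$\pi_{m,\epsilon}(\theta|\mathbf X_n)\to\frac{\pi(\theta)\,w(\mathcal D_\infty(\theta_0,\theta),\epsilon)}{\int_{\mathbb T}\pi(\theta')\,w(\mathcal D_\infty(\theta_0,\theta'),\epsilon)\,d\theta'}\qquad\text{almost surely as }n\to\infty.$$ 3. For every $\theta\in\mathbb T$, the integral defining $\mathcal D_\infty(\theta_0,\theta)$ converges, $\mathcal D_\infty(\theta_0,\theta)\ge0$, and $\mathcal D_\infty(\theta_0,\theta)=0$ if and only if $P_\theta=P_{\theta_0}$. Consequently, if the parameter is identifiable at $\theta_0$ (that is, $P_\theta=P_{\theta_0}$ implies $\theta=\theta_0$),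 then $\mathcal D_\infty(\theta_0,\theta)=0$ if and only if $\theta=\theta_0$. -/

import Mathlib

open MeasureTheory ProbabilityTheory Filter Topology

noncomputable section

namespace ABC

/-- `g` is a probability density function with respect to the measure `μ`. (A Bochner integral
equal to `1` is in particular the integral of an integrable function.) -/
structure IsPDF {S : Type*} [MeasurableSpace S] (μ : Measure S) (g : S → ℝ) : Prop where
  measurable : Measurable g
  nonneg : ∀ᵐ x ∂μ, 0 ≤ g x
  integral_eq_one : ∫ x, g x ∂μ = 1

/-- The probability distribution on `ℝ^d` with PDF `f (· | θ)` on the sample space `𝕏`. -/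
def modelLaw {d : ℕ} {T : Type*} (𝕏 : Set (EuclideanSpace ℝ (Fin d)))
    (f : EuclideanSpace ℝ (Fin d) → T → ℝ) (θ : T) : Measure (EuclideanSpace ℝ (Fin d)) :=
  (volume.restrict 𝕏).withDensity (fun x => ENNReal.ofReal (f x θ))

/-- `X 0, X 1, …` are independent random vectors, each with distribution `P`. -/
structure IsIID {Ω S : Type*} [MeasurableSpace Ω] [MeasurableSpace S] (μ : Measure Ω)
    (P : Measure S) (X : ℕ → Ω → S) : Prop where
  measurable : ∀ i, Measurable (X i)
  law : ∀ i, μ.map (X i) = P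
  indep : iIndepFun X μ

/-- The sample formed by the first `n` terms of a sequence. -/
def sample {S : Type*} (x : ℕ → S) (n : ℕ) : Fin n → S := fun i => x i

/-- The Euclidean metric `δ₁ (x, y) = ‖x - y‖₂`. -/
def delta1 {d : ℕ} (x y : EuclideanSpace ℝ (Fin d)) : ℝ := ‖x - y‖

/-- The V-statistic `V_δ (x_n, y_m)` of the energy statistic. -/
def vStat {S : Type*} (δ : S → S → ℝ) {n m : ℕ} (x : Fin n → S) (y : Fin m → S) : ℝ :=
  2 / ((m : ℝ) * (n : ℝ)) * ∑ i, ∑ j, δ (x i) (y j)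
    - 1 / (n : ℝ) ^ 2 * ∑ i, ∑ j, δ (x i) (x j)
    - 1 / (m : ℝ) ^ 2 * ∑ i, ∑ j, δ (y i) (y j)

/-- Weight functions `w (d, ε)`: for every `ε > 0`, non-negative, decreasing in the wide sense,
and bounded as a function of `d ∈ [0, ∞)`. -/
structure IsWeight (w : ℝ → ℝ → ℝ) : Prop where
  nonneg : ∀ ε, 0 < ε → ∀ r, 0 ≤ r → 0 ≤ w r ε
  antitone : ∀ ε, 0 < ε → AntitoneOn (fun r => w r ε) (Set.Ici 0)
  bounded : ∀ ε, 0 < ε → ∃ a : ℝ, ∀ r, 0 ≤ r → w r ε ≤ a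

/-- The continuity set of `r ↦ w (r, ε)`, as a function on `[0, ∞)`. -/
def contSet (w : ℝ → ℝ → ℝ) (ε : ℝ) : Set ℝ :=
  {r | 0 ≤ r ∧ ContinuousWithinAt (fun s => w s ε) (Set.Ici 0) r}

/-- The approximate likelihood
`L_{m,ε} (x_n | θ) = ∫_{𝕏^m} w (D (x_n, y_m), ε) ∏ᵢ f (yᵢ | θ) dy_m`. -/
def approxLikelihood {d : ℕ} {T : Type*} (𝕏 : Set (EuclideanSpace ℝ (Fin d)))
    (f : EuclideanSpace ℝ (Fin d) → T → ℝ) (w : ℝ → ℝ → ℝ) {n m : ℕ}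
    (D : (Fin n → EuclideanSpace ℝ (Fin d)) → (Fin m → EuclideanSpace ℝ (Fin d)) → ℝ)
    (ε : ℝ) (x : Fin n → EuclideanSpace ℝ (Fin d)) (θ : T) : ℝ :=
  ∫ y in Set.univ.pi (fun _ : Fin m => 𝕏), w (D x y) ε * ∏ i, f (y i) θ

/-- The normalization constant `c_{m,ε} (x_n) = ∫ π (θ) L_{m,ε} (x_n | θ) dθ`, where `ρ` is the
reference measure `dθ` of the parameter space. -/
def normConst {d : ℕ} {T : Type*} [MeasurableSpace T] (ρ : Measure T) (prior : T → ℝ)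
    (𝕏 : Set (EuclideanSpace ℝ (Fin d)))
    (f : EuclideanSpace ℝ (Fin d) → T → ℝ) (w : ℝ → ℝ → ℝ) {n m : ℕ}
    (D : (Fin n → EuclideanSpace ℝ (Fin d)) → (Fin m → EuclideanSpace ℝ (Fin d)) → ℝ)
    (ε : ℝ) (x : Fin n → EuclideanSpace ℝ (Fin d)) : ℝ :=
  ∫ θ, prior θ * approxLikelihood 𝕏 f w D ε x θ ∂ρ

/-- The pseudo-posterior PDF `π_{m,ε} (θ | x_n) = π (θ) L_{m,ε} (x_n | θ) / c_{m,ε} (x_n)`. -/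
def pseudoPosterior {d : ℕ} {T : Type*} [MeasurableSpace T] (ρ : Measure T) (prior : T → ℝ)
    (𝕏 : Set (EuclideanSpace ℝ (Fin d)))
    (f : EuclideanSpace ℝ (Fin d) → T → ℝ) (w : ℝ → ℝ → ℝ) {n m : ℕ}
    (D : (Fin n → EuclideanSpace ℝ (Fin d)) → (Fin m → EuclideanSpace ℝ (Fin d)) → ℝ)
    (ε : ℝ) (x : Fin n → EuclideanSpace ℝ (Fin d)) (θ : T) : ℝ :=
  prior θ * approxLikelihood 𝕏 f w D ε x θ / normConst ρ prior 𝕏 f w D ε x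

/-- The integrand `|φ(t; θ₀) - φ(t; θ)|² / ‖t‖^(d+1)`, where `φ(·; θ)` is the characteristic
function of the distribution with PDF `f (· | θ)`. -/
def energyIntegrand {d : ℕ} {T : Type*} (𝕏 : Set (EuclideanSpace ℝ (Fin d)))
    (f : EuclideanSpace ℝ (Fin d) → T → ℝ) (θ₀ θ : T) (t : EuclideanSpace ℝ (Fin d)) : ℝ :=
  ‖charFun (modelLaw 𝕏 f θ₀) t - charFun (modelLaw 𝕏 f θ) t‖ ^ 2 / ‖t‖ ^ (d + 1)

/-- The limiting discrepancy `D_∞ (θ₀, θ)`. -/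
def dInf {d : ℕ} {T : Type*} (𝕏 : Set (EuclideanSpace ℝ (Fin d)))
    (f : EuclideanSpace ℝ (Fin d) → T → ℝ) (θ₀ θ : T) : ℝ :=
  Real.Gamma (((d : ℝ) + 1) / 2) / Real.pi ^ (((d : ℝ) + 1) / 2)
    * ∫ t : EuclideanSpace ℝ (Fin d), energyIntegrand 𝕏 f θ₀ θ t

end ABC

end

noncomputable section

namespace ABC

open Set in
/-- The `lintegral` form of `∫ u ^ (p - 1) exp (-b u) du = Γ(p) / b ^ p`. -/
theorem lintegral_rpow_mul_exp_neg_mul {p b : ℝ} (hp : 0 < p) (hb : 0 < b) :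
    ∫⁻ u in Ioi (0 : ℝ), ENNReal.ofReal (u ^ (p - 1) * Real.exp (-(b * u)))
      = ENNReal.ofReal (Real.Gamma p * (1 / b) ^ p) := by
  have hint : IntegrableOn (fun u : ℝ => u ^ (p - 1) * Real.exp (-(b * u))) (Ioi 0) := by
    have h := integrableOn_rpow_mul_exp_neg_mul_rpow (p := 1) (s := p - 1) (b := b)
      (by linarith) one_pos hb
    simpa using h
  rw [← ofReal_integral_eq_lintegral_ofReal hint, Real.integral_rpow_mul_exp_neg_mul_Ioi hp hb,
    mul_comm]
  filter_upwards [ae_restrict_mem measurableSet_Ioi] with u hu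
  have : (0 : ℝ) < u := hu
  positivity

open Set in
/-- The integral of the inverse-gamma kernel. -/
theorem lintegral_rpow_mul_exp_neg_div {p b : ℝ} (hp : 0 < p) (hb : 0 < b) :
    ∫⁻ s in Ioi (0 : ℝ), ENNReal.ofReal (s ^ (-p - 1) * Real.exp (-(b / s)))
      = ENNReal.ofReal (Real.Gamma p * (1 / b) ^ p) := by
  have hint : IntegrableOn (fun u : ℝ => u ^ (p - 1) * Real.exp (-(b * u))) (Ioi 0) := by
    have h := integrableOn_rpow_mul_exp_neg_mul_rpow (p := 1) (s := p - 1) (b := b)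
      (by linarith) one_pos hb
    simpa using h
  have heq : EqOn (fun s : ℝ => (|(-1 : ℝ)| * s ^ ((-1 : ℝ) - 1)) •
      ((s ^ (-1 : ℝ)) ^ (p - 1) * Real.exp (-(b * s ^ (-1 : ℝ)))))
      (fun s => s ^ (-p - 1) * Real.exp (-(b / s))) (Ioi 0) := by
    intro s hs
    have hs : (0 : ℝ) < s := hs
    simp only [abs_neg, abs_one, one_mul, smul_eq_mul]
    rw [← Real.rpow_mul hs.le, ← mul_assoc, ← Real.rpow_add hs, Real.rpow_neg_one, div_eq_mul_inv]
    ring_nf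
  have hint' := (integrableOn_Ioi_comp_rpow_iff _ (p := -1) (by norm_num)).2 hint
  rw [integrableOn_congr_fun heq measurableSet_Ioi] at hint'
  rw [← ofReal_integral_eq_lintegral_ofReal hint',
    ← setIntegral_congr_fun measurableSet_Ioi heq,
    integral_comp_rpow_Ioi (fun u : ℝ => u ^ (p - 1) * Real.exp (-(b * u))) (by norm_num),
    Real.integral_rpow_mul_exp_neg_mul_Ioi hp hb, mul_comm]
  filter_upwards [ae_restrict_mem measurableSet_Ioi] with u hu
  have : (0 : ℝ) < u := hu
  positivity

open Set in
theorem lintegral_Ioc_exp_neg_div {c s : ℝ} (hc : 0 ≤ c) (hs : 0 < s) :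
    ∫⁻ a in Ioc 0 c, ENNReal.ofReal (s ^ (-(1 / 2 : ℝ) - 1) * Real.exp (-(a / s)))
      = ENNReal.ofReal (s ^ (-(1 / 2 : ℝ)) * (1 - Real.exp (-(c / s)))) := by
  have hcont : Continuous fun a : ℝ => s ^ (-(1 / 2 : ℝ) - 1) * Real.exp (-(a / s)) := by fun_prop
  have hd : ∀ a ∈ uIcc 0 c, HasDerivAt (fun a => -(s ^ (-(1 / 2 : ℝ)) * Real.exp (-(a / s))))
      (s ^ (-(1 / 2 : ℝ) - 1) * Real.exp (-(a / s))) a := by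
    intro a _
    have h := ((((hasDerivAt_id a).div_const s).neg.exp).const_mul (s ^ (-(1 / 2 : ℝ)))).neg
    convert! h using 1
    rw [Real.rpow_sub_one hs.ne']
    simp only [Pi.neg_apply, id]
    ring
  rw [← ofReal_integral_eq_lintegral_ofReal, ← intervalIntegral.integral_of_le hc,
    intervalIntegral.integral_eq_sub_of_hasDerivAt hd (hcont.intervalIntegrable _ _)]
  · congr 1
    simp
    ring
  · exact hcont.continuousOn.integrableOn_Icc.mono_set Ioc_subset_Icc_self
  · exact ae_of_all _ fun a => by positivity

open Set in
theorem lintegral_rpow_mul_one_sub_exp_neg_div {c : ℝ} (hc : 0 ≤ c) :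
    ∫⁻ s in Ioi (0 : ℝ), ENNReal.ofReal (s ^ (-(1 / 2 : ℝ)) * (1 - Real.exp (-(c / s))))
      = ENNReal.ofReal (2 * √Real.pi * √c) := by
  calc ∫⁻ s in Ioi (0 : ℝ), ENNReal.ofReal (s ^ (-(1 / 2 : ℝ)) * (1 - Real.exp (-(c / s))))
      = ∫⁻ s in Ioi (0 : ℝ), ∫⁻ a in Ioc 0 c,
          ENNReal.ofReal (s ^ (-(1 / 2 : ℝ) - 1) * Real.exp (-(a / s))) :=
        setLIntegral_congr_fun measurableSet_Ioi fun s hs =>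
          (lintegral_Ioc_exp_neg_div hc hs).symm
    _ = ∫⁻ a in Ioc 0 c, ∫⁻ s in Ioi (0 : ℝ),
          ENNReal.ofReal (s ^ (-(1 / 2 : ℝ) - 1) * Real.exp (-(a / s))) :=
        lintegral_lintegral_swap (Measurable.aemeasurable (by fun_prop))
    _ = ∫⁻ a in Ioc 0 c, ENNReal.ofReal (√Real.pi * a ^ (-(1 / 2) : ℝ)) := by
        refine setLIntegral_congr_fun measurableSet_Ioc fun a ha => ?_
        rw [lintegral_rpow_mul_exp_neg_div (by norm_num) ha.1, Real.Gamma_one_half_eq,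
          one_div a, Real.inv_rpow ha.1.le, Real.rpow_neg ha.1.le]
    _ = ENNReal.ofReal (2 * √Real.pi * √c) := by
        rw [← ofReal_integral_eq_lintegral_ofReal, ← intervalIntegral.integral_of_le hc,
          intervalIntegral.integral_const_mul, integral_rpow (Or.inl (by norm_num))]
        · congr 1
          norm_num
          rw [Real.sqrt_eq_rpow c]
          ring
        · exact ((intervalIntegral.intervalIntegrable_rpow' (by norm_num)).1).const_mul _
        · filter_upwards [ae_restrict_mem measurableSet_Ioc] with a ha
          have := ha.1
          positivity

section Gaussian

variable {V : Type*} [NormedAddCommGroup V] [InnerProductSpace ℝ V] [FiniteDimensional ℝ V]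
  [MeasurableSpace V] [BorelSpace V]

theorem integrable_exp_neg_mul_sq_norm {b : ℝ} (hb : 0 < b) :
    Integrable fun v : V => Real.exp (-b * ‖v‖ ^ 2) := by
  have h := (GaussianFourier.integrable_cexp_neg_mul_sq_norm_add (V := V) (b := (b : ℂ))
    (by simpa using hb) 0 0).norm
  refine h.congr (ae_of_all _ fun v => ?_)
  simp [Complex.norm_exp, ← Complex.ofReal_pow, ← Complex.ofReal_mul]

theorem integral_cos_inner_mul_exp_neg_mul_sq_norm {b : ℝ} (hb : 0 < b) (x : V) :
    ∫ v : V, Real.cos (inner ℝ x v) * Real.exp (-b * ‖v‖ ^ 2)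
      = (Real.pi / b) ^ (Module.finrank ℝ V / 2 : ℝ) * Real.exp (-(‖x‖ ^ 2 / 4 / b)) := by
  have hb' : 0 < (b : ℂ).re := by simpa using hb
  have h := GaussianFourier.integral_cexp_neg_mul_sq_norm_add hb' Complex.I x
  have hint := GaussianFourier.integrable_cexp_neg_mul_sq_norm_add hb' Complex.I x
  have hre := congrArg Complex.re h
  rw [← RCLike.re_eq_complex_re, ← integral_re hint] at hre
  have h1 : ∀ v : V, RCLike.re (Complex.exp (-(b : ℂ) * (‖v‖ : ℂ) ^ 2
      + Complex.I * (inner ℝ x v : ℝ))) = Real.cos (inner ℝ x v) * Real.exp (-b * ‖v‖ ^ 2) := by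
    intro v
    rw [RCLike.re_eq_complex_re, Complex.exp_re]
    simp [← Complex.ofReal_pow, ← Complex.ofReal_mul, mul_comm]
  simp_rw [h1] at hre
  rw [hre]
  have h2 : ((Real.pi : ℂ) / b) ^ (Module.finrank ℝ V / 2 : ℂ)
      * Complex.exp (Complex.I ^ 2 * (‖x‖ : ℂ) ^ 2 / (4 * b))
      = (((Real.pi / b) ^ (Module.finrank ℝ V / 2 : ℝ) * Real.exp (-(‖x‖ ^ 2 / 4 / b)) : ℝ) : ℂ) := by
    rw [Complex.ofReal_mul, Complex.ofReal_cpow (by positivity), Complex.ofReal_exp]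
    push_cast
    congr 2
    rw [Complex.I_sq]
    field_simp
  rw [h2, RCLike.re_eq_complex_re, Complex.ofReal_re]

theorem lintegral_one_sub_cos_inner_mul_exp {b : ℝ} (hb : 0 < b) (x : V) :
    ∫⁻ v : V, ENNReal.ofReal ((1 - Real.cos (inner ℝ x v)) * Real.exp (-b * ‖v‖ ^ 2))
      = ENNReal.ofReal ((Real.pi / b) ^ (Module.finrank ℝ V / 2 : ℝ)
          * (1 - Real.exp (-(‖x‖ ^ 2 / 4 / b)))) := by
  have hint := integrable_exp_neg_mul_sq_norm (V := V) hb
  have hint2 : Integrable fun v : V => Real.cos (inner ℝ x v) * Real.exp (-b * ‖v‖ ^ 2) := by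
    refine hint.bdd_mul (c := 1) (by fun_prop) (ae_of_all _ fun v => ?_)
    simpa using Real.abs_cos_le_one _
  have hsub : (fun v : V => (1 - Real.cos (inner ℝ x v)) * Real.exp (-b * ‖v‖ ^ 2))
      = fun v => Real.exp (-b * ‖v‖ ^ 2) - Real.cos (inner ℝ x v) * Real.exp (-b * ‖v‖ ^ 2) := by
    funext v; ring
  rw [← ofReal_integral_eq_lintegral_ofReal (by rw [hsub]; exact hint.sub hint2), hsub,
    integral_sub hint hint2, GaussianFourier.integral_rexp_neg_mul_sq_norm hb,
    integral_cos_inner_mul_exp_neg_mul_sq_norm hb, mul_sub, mul_one]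
  exact ae_of_all _ fun v =>
    mul_nonneg (sub_nonneg.2 (Real.cos_le_one _)) (Real.exp_pos _).le

/-- The normalizing constant `π ^ ((d + 1) / 2) / Γ ((d + 1) / 2)` of the energy distance. -/
def energyConst (d : ℕ) : ℝ :=
  Real.pi ^ (((d : ℝ) + 1) / 2) / Real.Gamma (((d : ℝ) + 1) / 2)

theorem energyConst_pos (d : ℕ) : 0 < energyConst d :=
  div_pos (by positivity) (Real.Gamma_pos_of_pos (by positivity))

open Set in
theorem lintegral_one_sub_cos_inner_div_norm_pow [Nontrivial V] (x : V) :
    ∫⁻ t : V, ENNReal.ofReal ((1 - Real.cos (inner ℝ x t)) / ‖t‖ ^ (Module.finrank ℝ V + 1))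
      = ENNReal.ofReal (energyConst (Module.finrank ℝ V) * ‖x‖) := by
  set d := Module.finrank ℝ V with hd
  set p : ℝ := ((d : ℝ) + 1) / 2 with hp
  have hp0 : 0 < p := by positivity
  have hG : 0 < Real.Gamma p := Real.Gamma_pos_of_pos hp0
  have hsub : ∀ t : V, t ≠ 0 →
      ENNReal.ofReal ((1 - Real.cos (inner ℝ x t)) / ‖t‖ ^ (d + 1))
        = ∫⁻ s in Ioi (0 : ℝ), ENNReal.ofReal (s ^ (p - 1) / Real.Gamma p)
            * ENNReal.ofReal ((1 - Real.cos (inner ℝ x t)) * Real.exp (-s * ‖t‖ ^ 2)) := by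
    intro t ht
    have ht' : 0 < ‖t‖ := norm_pos_iff.2 ht
    have hc : 0 ≤ 1 - Real.cos (inner ℝ x t) := sub_nonneg.2 (Real.cos_le_one _)
    have h1 : ∀ s ∈ Ioi (0 : ℝ), ENNReal.ofReal (s ^ (p - 1) / Real.Gamma p)
            * ENNReal.ofReal ((1 - Real.cos (inner ℝ x t)) * Real.exp (-s * ‖t‖ ^ 2))
        = ENNReal.ofReal ((1 - Real.cos (inner ℝ x t)) / Real.Gamma p)
          * ENNReal.ofReal (s ^ (p - 1) * Real.exp (-(‖t‖ ^ 2 * s))) := by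
      intro s hs
      have hs : (0 : ℝ) < s := hs
      rw [← ENNReal.ofReal_mul (by positivity), ← ENNReal.ofReal_mul (by positivity)]
      congr 1
      rw [show -s * ‖t‖ ^ 2 = -(‖t‖ ^ 2 * s) by ring]
      ring
    rw [setLIntegral_congr_fun measurableSet_Ioi h1, lintegral_const_mul _ (by fun_prop),
      lintegral_rpow_mul_exp_neg_mul hp0 (by positivity), ← ENNReal.ofReal_mul (by positivity)]
    congr 1
    have h2 : (1 / ‖t‖ ^ 2) ^ p = 1 / ‖t‖ ^ (d + 1) := by
      rw [Real.div_rpow zero_le_one (by positivity), Real.one_rpow, ← Real.rpow_natCast_mul ht'.le,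
        ← Real.rpow_natCast ‖t‖ (d + 1)]
      congr 2
      rw [hp]; push_cast; ring
    rw [h2]
    field_simp
  calc ∫⁻ t : V, ENNReal.ofReal ((1 - Real.cos (inner ℝ x t)) / ‖t‖ ^ (d + 1))
      = ∫⁻ t : V, ∫⁻ s in Ioi (0 : ℝ), ENNReal.ofReal (s ^ (p - 1) / Real.Gamma p)
            * ENNReal.ofReal ((1 - Real.cos (inner ℝ x t)) * Real.exp (-s * ‖t‖ ^ 2)) := by
        refine lintegral_congr_ae ?_
        filter_upwards [compl_mem_ae_iff.2 (measure_singleton (0 : V))] with t ht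
        exact hsub t ht
    _ = ∫⁻ s in Ioi (0 : ℝ), ∫⁻ t : V, ENNReal.ofReal (s ^ (p - 1) / Real.Gamma p)
            * ENNReal.ofReal ((1 - Real.cos (inner ℝ x t)) * Real.exp (-s * ‖t‖ ^ 2)) :=
        lintegral_lintegral_swap (Measurable.aemeasurable (by fun_prop))
    _ = ∫⁻ s in Ioi (0 : ℝ), ENNReal.ofReal (Real.pi ^ ((d : ℝ) / 2) / Real.Gamma p)
          * ENNReal.ofReal (s ^ (-(1 / 2 : ℝ)) * (1 - Real.exp (-(‖x‖ ^ 2 / 4 / s)))) := by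
        refine setLIntegral_congr_fun measurableSet_Ioi fun s hs => ?_
        have hs : (0 : ℝ) < s := hs
        rw [lintegral_const_mul _ (by fun_prop), lintegral_one_sub_cos_inner_mul_exp hs,
          ← ENNReal.ofReal_mul (by positivity), ← ENNReal.ofReal_mul (by positivity)]
        congr 1
        rw [Real.div_rpow Real.pi_pos.le hs.le, show -(1 / 2 : ℝ) = (p - 1) - (d : ℝ) / 2 by
          rw [hp]; ring, Real.rpow_sub hs (p - 1), ← hd]
        ring
    _ = ENNReal.ofReal (energyConst d * ‖x‖) := by
        rw [lintegral_const_mul _ (by fun_prop),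
          lintegral_rpow_mul_one_sub_exp_neg_div (by positivity),
          ← ENNReal.ofReal_mul (by positivity)]
        congr 1
        rw [energyConst, ← hp, show p = (d : ℝ) / 2 + 1 / 2 by rw [hp]; ring,
          Real.rpow_add Real.pi_pos, ← Real.sqrt_eq_rpow,
          show ‖x‖ ^ 2 / 4 = (‖x‖ / 2) ^ 2 by ring, Real.sqrt_sq (by positivity)]
        ring

end Gaussian

theorem integrable_norm_sub_prod {V : Type*} [NormedAddCommGroup V]
    [MeasurableSpace V] {P Q : Measure V} [IsProbabilityMeasure P]
    [IsProbabilityMeasure Q] (hP : Integrable (fun x => x) P) (hQ : Integrable (fun x => x) Q) :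
    Integrable (fun z : V × V => ‖z.1 - z.2‖) (P.prod Q) :=
  ((hP.comp_fst Q).sub (hQ.comp_snd P)).norm

section Empirical

variable {V : Type*} [MeasurableSpace V]

/-- The empirical distribution of a sample. -/
def empirical {n : ℕ} (x : Fin n → V) : Measure V :=
  (n : ENNReal)⁻¹ • ∑ i, Measure.dirac (x i)

theorem isProbabilityMeasure_empirical {n : ℕ} (hn : 0 < n) (x : Fin n → V) :
    IsProbabilityMeasure (empirical x) := by
  refine ⟨?_⟩
  simp [empirical, ENNReal.inv_mul_cancel, hn.ne']

theorem integrable_empirical [MeasurableSingletonClass V] {n : ℕ} (hn : 0 < n) (x : Fin n → V) {E : Type*}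
    [NormedAddCommGroup E] {g : V → E} : Integrable g (empirical x) := by
  refine Integrable.smul_measure ?_ (by simp [hn.ne'])
  exact integrable_finsetSum_measure.2 fun i _ => integrable_dirac (by simp)

theorem integral_empirical [MeasurableSingletonClass V] {n : ℕ} (x : Fin n → V) (g : V → ℝ) :
    ∫ v, g v ∂(empirical x) = (n : ℝ)⁻¹ * ∑ i, g (x i) := by
  rw [empirical, integral_smul_measure, integral_finsetSum_measure]
  · simp
  · exact fun i _ => integrable_dirac (by simp)

end Empirical

theorem integral_norm_sub_prod_empirical {V : Type*} [NormedAddCommGroup V] [MeasurableSpace V]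
    [SecondCountableTopology V] [BorelSpace V] {n m : ℕ} (hn : 0 < n) (hm : 0 < m) (x : Fin n → V)
    (y : Fin m → V) :
    ∫ z, ‖z.1 - z.2‖ ∂((empirical x).prod (empirical y))
      = (n : ℝ)⁻¹ * ((m : ℝ)⁻¹ * ∑ i, ∑ j, ‖x i - y j‖) := by
  have := isProbabilityMeasure_empirical hn x
  have := isProbabilityMeasure_empirical hm y
  rw [integral_prod _ (integrable_norm_sub_prod (integrable_empirical hn x)
    (integrable_empirical hm y))]
  simp only [integral_empirical, Finset.mul_sum]

section Energy

variable {V : Type*} [NormedAddCommGroup V] [InnerProductSpace ℝ V] [FiniteDimensional ℝ V]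
  [MeasurableSpace V] [BorelSpace V]

theorem integral_one_sub_cos_inner_sub (P Q : Measure V) [IsProbabilityMeasure P]
    [IsProbabilityMeasure Q] (t : V) :
    ∫ z, (1 - Real.cos (inner ℝ (z.1 - z.2) t)) ∂(P.prod Q)
      = 1 - (charFun P t * (starRingEnd ℂ) (charFun Q t)).re := by
  have hint : Integrable (fun z : V × V => Complex.exp (inner ℝ (z.1 - z.2) t * Complex.I))
      (P.prod Q) := by
    refine (integrable_const (1 : ℝ)).mono (by fun_prop) (ae_of_all _ fun z => ?_)
    simp [Complex.norm_exp_ofReal_mul_I]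
  have h : charFun P t * (starRingEnd ℂ) (charFun Q t)
      = ∫ z, Complex.exp (inner ℝ (z.1 - z.2) t * Complex.I) ∂(P.prod Q) := by
    rw [← charFun_neg, charFun_apply, charFun_apply, ← integral_prod_mul]
    congr 1 with z
    rw [← Complex.exp_add, inner_neg_right, inner_sub_left]
    push_cast
    ring_nf
  have hre : ∀ z : V × V, RCLike.re (Complex.exp (inner ℝ (z.1 - z.2) t * Complex.I))
      = Real.cos (inner ℝ (z.1 - z.2) t) := fun z => Complex.exp_ofReal_mul_I_re _
  have hre_int := hint.re
  simp_rw [hre] at hre_int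
  rw [integral_sub (integrable_const _) hre_int, h, ← RCLike.re_eq_complex_re, ← integral_re hint]
  simp_rw [hre]
  simp

theorem sq_norm_charFun_sub (P Q : Measure V) [IsProbabilityMeasure P]
    [IsProbabilityMeasure Q] (t : V) :
    ‖charFun P t - charFun Q t‖ ^ 2
      = 2 * ∫ z, (1 - Real.cos (inner ℝ (z.1 - z.2) t)) ∂(P.prod Q)
        - ∫ z, (1 - Real.cos (inner ℝ (z.1 - z.2) t)) ∂(P.prod P)
        - ∫ z, (1 - Real.cos (inner ℝ (z.1 - z.2) t)) ∂(Q.prod Q) := by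
  simp_rw [integral_one_sub_cos_inner_sub]
  rw [← Complex.normSq_eq_norm_sq, Complex.normSq_apply]
  simp only [Complex.mul_re, Complex.conj_re, Complex.conj_im, Complex.sub_re, Complex.sub_im]
  ring

theorem continuous_charFun_of_isProbabilityMeasure (P : Measure V) [IsProbabilityMeasure P] :
    Continuous (charFun P) := by
  refine continuous_of_dominated (bound := fun _ => 1) (fun t => by fun_prop)
    (fun t => ae_of_all _ fun x => ?_) (integrable_const _) (ae_of_all _ fun x => by fun_prop)
  rw [Complex.norm_exp_ofReal_mul_I]

variable [Nontrivial V]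

theorem integrable_one_sub_cos_inner_div (x : V) :
    Integrable fun t : V => (1 - Real.cos (inner ℝ x t)) / ‖t‖ ^ (Module.finrank ℝ V + 1) := by
  refine ⟨Measurable.aestronglyMeasurable (by fun_prop), ?_⟩
  rw [hasFiniteIntegral_iff_ofReal, lintegral_one_sub_cos_inner_div_norm_pow]
  · exact ENNReal.ofReal_lt_top
  · exact ae_of_all _ fun t => div_nonneg (sub_nonneg.2 (Real.cos_le_one _)) (by positivity)

theorem integral_one_sub_cos_inner_div (x : V) :
    ∫ t : V, (1 - Real.cos (inner ℝ x t)) / ‖t‖ ^ (Module.finrank ℝ V + 1)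
      = energyConst (Module.finrank ℝ V) * ‖x‖ := by
  rw [integral_eq_lintegral_of_nonneg_ae, lintegral_one_sub_cos_inner_div_norm_pow,
    ENNReal.toReal_ofReal (mul_nonneg (energyConst_pos _).le (norm_nonneg x))]
  · exact ae_of_all _ fun t => div_nonneg (sub_nonneg.2 (Real.cos_le_one _)) (by positivity)
  · exact Measurable.aestronglyMeasurable (by fun_prop)

theorem integrable_prod_one_sub_cos {P Q : Measure V} [IsProbabilityMeasure P]
    [IsProbabilityMeasure Q] (hP : Integrable (fun x => x) P) (hQ : Integrable (fun x => x) Q) :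
    Integrable (fun p : V × (V × V) =>
      (1 - Real.cos (inner ℝ (p.2.1 - p.2.2) p.1)) / ‖p.1‖ ^ (Module.finrank ℝ V + 1))
      (volume.prod (P.prod Q)) := by
  rw [integrable_prod_iff' (Measurable.aestronglyMeasurable (by fun_prop))]
  refine ⟨ae_of_all _ fun z => integrable_one_sub_cos_inner_div (z.1 - z.2), ?_⟩
  have h : ∀ z : V × V, ∫ t : V,
      ‖(1 - Real.cos (inner ℝ (z.1 - z.2) t)) / ‖t‖ ^ (Module.finrank ℝ V + 1)‖
      = energyConst (Module.finrank ℝ V) * ‖z.1 - z.2‖ := by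
    intro z
    rw [← integral_one_sub_cos_inner_div]
    congr 1 with t
    exact Real.norm_of_nonneg (div_nonneg (sub_nonneg.2 (Real.cos_le_one _)) (by positivity))
  simp_rw [h]
  exact (integrable_norm_sub_prod hP hQ).const_mul _

theorem integrable_integral_one_sub_cos_div {P Q : Measure V} [IsProbabilityMeasure P]
    [IsProbabilityMeasure Q] (hP : Integrable (fun x => x) P) (hQ : Integrable (fun x => x) Q) :
    Integrable fun t : V => (∫ z, (1 - Real.cos (inner ℝ (z.1 - z.2) t)) ∂(P.prod Q))
      / ‖t‖ ^ (Module.finrank ℝ V + 1) := by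
  simpa only [integral_div] using (integrable_prod_one_sub_cos hP hQ).integral_prod_left

theorem integral_integral_one_sub_cos_div {P Q : Measure V} [IsProbabilityMeasure P]
    [IsProbabilityMeasure Q] (hP : Integrable (fun x => x) P) (hQ : Integrable (fun x => x) Q) :
    ∫ t : V, (∫ z, (1 - Real.cos (inner ℝ (z.1 - z.2) t)) ∂(P.prod Q))
      / ‖t‖ ^ (Module.finrank ℝ V + 1)
      = energyConst (Module.finrank ℝ V) * ∫ z, ‖z.1 - z.2‖ ∂(P.prod Q) := by
  simp_rw [← integral_div]
  rw [integral_integral_swap (integrable_prod_one_sub_cos hP hQ), ← integral_const_mul]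
  simp_rw [integral_one_sub_cos_inner_div]

/-- The energy distance `2 E‖X - Y‖ - E‖X - X'‖ - E‖Y - Y'‖`. -/
def energyDist (P Q : Measure V) : ℝ :=
  2 * ∫ z, ‖z.1 - z.2‖ ∂(P.prod Q) - ∫ z, ‖z.1 - z.2‖ ∂(P.prod P)
    - ∫ z, ‖z.1 - z.2‖ ∂(Q.prod Q)

variable {P Q : Measure V} [IsProbabilityMeasure P] [IsProbabilityMeasure Q]

theorem integrable_sq_norm_charFun_sub_div
    (hP : Integrable (fun x => x) P) (hQ : Integrable (fun x => x) Q) :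
    Integrable fun t : V =>
      ‖charFun P t - charFun Q t‖ ^ 2 / ‖t‖ ^ (Module.finrank ℝ V + 1) := by
  simp_rw [sq_norm_charFun_sub, sub_div, mul_div_assoc]
  exact (((integrable_integral_one_sub_cos_div hP hQ).const_mul 2).sub
    (integrable_integral_one_sub_cos_div hP hP)).sub (integrable_integral_one_sub_cos_div hQ hQ)

theorem integral_sq_norm_charFun_sub_div
    (hP : Integrable (fun x => x) P) (hQ : Integrable (fun x => x) Q) :
    ∫ t : V, ‖charFun P t - charFun Q t‖ ^ 2 / ‖t‖ ^ (Module.finrank ℝ V + 1)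
      = energyConst (Module.finrank ℝ V) * energyDist P Q := by
  have hPQ := (integrable_integral_one_sub_cos_div hP hQ).const_mul 2
  have hPP := integrable_integral_one_sub_cos_div hP hP
  have hQQ := integrable_integral_one_sub_cos_div hQ hQ
  have hsub := hPQ.sub hPP
  simp only [Pi.sub_def] at hsub
  simp_rw [sq_norm_charFun_sub, sub_div, mul_div_assoc]
  rw [integral_sub hsub hQQ, integral_sub hPQ hPP, integral_const_mul,
    integral_integral_one_sub_cos_div hP hQ, integral_integral_one_sub_cos_div hP hP,
    integral_integral_one_sub_cos_div hQ hQ, energyDist]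
  ring

theorem energyDist_nonneg (hP : Integrable (fun x => x) P) (hQ : Integrable (fun x => x) Q) :
    0 ≤ energyDist P Q := by
  refine nonneg_of_mul_nonneg_right ?_ (energyConst_pos (Module.finrank ℝ V))
  rw [← integral_sq_norm_charFun_sub_div hP hQ]
  exact integral_nonneg fun t => by positivity

theorem energyDist_eq_zero_iff
    (hP : Integrable (fun x => x) P) (hQ : Integrable (fun x => x) Q) :
    energyDist P Q = 0 ↔ P = Q := by
  refine ⟨fun h => ?_, fun h => ?_⟩
  · have h0 := integral_sq_norm_charFun_sub_div hP hQ
    rw [h, mul_zero, integral_eq_zero_iff_of_nonneg (fun t => by positivity)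
      (integrable_sq_norm_charFun_sub_div hP hQ)] at h0
    refine Measure.ext_of_charFun ?_
    refine (continuous_charFun_of_isProbabilityMeasure P).ae_eq_iff_eq volume
      (continuous_charFun_of_isProbabilityMeasure Q) |>.1 ?_
    filter_upwards [h0, compl_mem_ae_iff.2 (measure_singleton (0 : V))] with t ht ht0
    have ht0 : t ≠ 0 := ht0
    have hpos : ‖t‖ ^ (Module.finrank ℝ V + 1) ≠ 0 := pow_ne_zero _ (norm_ne_zero_iff.2 ht0)
    have : ‖charFun P t - charFun Q t‖ ^ 2 = 0 := by
      simpa [hpos, ht0] using ht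
    exact sub_eq_zero.1 (norm_eq_zero.1 (pow_eq_zero_iff two_ne_zero |>.1 this))
  · subst h
    rw [energyDist]
    ring

end Energy

theorem vStat_eq_energyDist {d n m : ℕ} (hd : 0 < d) (hn : 0 < n) (hm : 0 < m)
    (x : Fin n → EuclideanSpace ℝ (Fin d)) (y : Fin m → EuclideanSpace ℝ (Fin d)) :
    vStat delta1 x y = energyDist (empirical x) (empirical y) := by
  have : Nonempty (Fin d) := ⟨⟨0, hd⟩⟩
  rw [energyDist, integral_norm_sub_prod_empirical hn hm, integral_norm_sub_prod_empirical hn hn,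
    integral_norm_sub_prod_empirical hm hm, vStat]
  simp only [delta1]
  field_simp

theorem vStat_nonneg {d n m : ℕ} (hd : 0 < d) (hn : 0 < n) (hm : 0 < m)
    (x : Fin n → EuclideanSpace ℝ (Fin d)) (y : Fin m → EuclideanSpace ℝ (Fin d)) :
    0 ≤ vStat delta1 x y := by
  have : Nonempty (Fin d) := ⟨⟨0, hd⟩⟩
  have := isProbabilityMeasure_empirical hn x
  have := isProbabilityMeasure_empirical hm y
  rw [vStat_eq_energyDist hd hn hm]
  exact energyDist_nonneg (integrable_empirical hn x) (integrable_empirical hm y)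

section Averages

/-- The averages of `g` along the sequence `x` converge to the expectation of `g` under `P`. -/
def AverageTendsto {S : Type*} [MeasurableSpace S] (P : Measure S) (x : ℕ → S) (g : S → ℝ) : Prop :=
  Tendsto (fun n : ℕ => (n : ℝ)⁻¹ * ∑ i ∈ Finset.range n, g (x i)) atTop (𝓝 (∫ v, g v ∂P))

theorem IsIID.ae_averageTendsto {Ω S : Type*} [MeasurableSpace Ω] [MeasurableSpace S]
    {μ : Measure Ω} {P : Measure S} {X : ℕ → Ω → S} (hX : IsIID μ P X) {g : S → ℝ}
    (hg : Measurable g) (hgP : Integrable g P) :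
    ∀ᵐ ω ∂μ, AverageTendsto P (fun i => X i ω) g := by
  have hint : Integrable (fun ω => g (X 0 ω)) μ := by
    rw [← hX.law 0] at hgP
    exact hgP.comp_measurable (hX.measurable 0)
  have hmean : ∫ ω, g (X 0 ω) ∂μ = ∫ v, g v ∂P := by
    rw [← hX.law 0, integral_map (hX.measurable 0).aemeasurable hg.aestronglyMeasurable]
  have h := strong_law_ae (fun i ω => g (X i ω)) hint
    (fun i j hij => (hX.indep.indepFun hij).comp hg hg)
    (fun i => IdentDistrib.comp ⟨(hX.measurable i).aemeasurable, (hX.measurable 0).aemeasurable,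
      by rw [hX.law, hX.law]⟩ hg)
  rw [hmean] at h
  exact h

variable {V : Type*} [NormedAddCommGroup V]

/-- The mean distance between the first `n` terms of `x` and the first `m` terms of `y`. -/
def meanDist (x y : ℕ → V) (n m : ℕ) : ℝ :=
  (n : ℝ)⁻¹ * ((m : ℝ)⁻¹ * ∑ i ∈ Finset.range n, ∑ j ∈ Finset.range m, ‖x i - y j‖)

theorem abs_meanDist_sub_le (x x' y : ℕ → V) (n m : ℕ) :
    |meanDist x y n m - meanDist x' y n m|
      ≤ (n : ℝ)⁻¹ * ∑ i ∈ Finset.range n, ‖x i - x' i‖ := by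
  rw [meanDist, meanDist, ← mul_sub, ← mul_sub, ← Finset.sum_sub_distrib, abs_mul,
    abs_of_nonneg (by positivity)]
  refine mul_le_mul_of_nonneg_left ?_ (by positivity)
  rw [abs_mul, abs_of_nonneg (by positivity)]
  have h : |∑ i ∈ Finset.range n, (∑ j ∈ Finset.range m, ‖x i - y j‖
      - ∑ j ∈ Finset.range m, ‖x' i - y j‖)| ≤ m * ∑ i ∈ Finset.range n, ‖x i - x' i‖ := by
    refine (Finset.abs_sum_le_sum_abs _ _).trans ?_
    rw [Finset.mul_sum]
    refine Finset.sum_le_sum fun i _ => ?_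
    rw [← Finset.sum_sub_distrib]
    refine (Finset.abs_sum_le_sum_abs _ _).trans ?_
    refine (Finset.sum_le_card_nsmul _ _ ‖x i - x' i‖ fun j _ => ?_).trans (by simp)
    refine (abs_norm_sub_norm_le _ _).trans (by simp)
  rcases Nat.eq_zero_or_pos m with rfl | hm
  · simp only [Nat.cast_zero, inv_zero, zero_mul]
    positivity
  · rw [inv_mul_le_iff₀ (by positivity)]
    exact h

variable [MeasurableSpace V] [BorelSpace V]
  [SecondCountableTopology V]

/-- A sequence of simple functions converging pointwise to the identity. -/
def simpleApprox (V : Type*) [NormedAddCommGroup V] [MeasurableSpace V] [BorelSpace V]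
    [SecondCountableTopology V] (k : ℕ) : SimpleFunc V V :=
  SimpleFunc.approxOn id measurable_id Set.univ 0 (Set.mem_univ 0) k

/-- The averages along `x` converge for a countable family of functions determining the
asymptotics of the mean pairwise distances. -/
structure IsTypical (P : Measure V) (x : ℕ → V) : Prop where
  approx : ∀ k, AverageTendsto P x fun v => ‖v - simpleApprox V k v‖
  freq : ∀ k, ∀ a ∈ (simpleApprox V k).range,
    AverageTendsto P x ((simpleApprox V k ⁻¹' {a}).indicator fun _ => (1 : ℝ))
  dist : ∀ k, ∀ a ∈ (simpleApprox V k).range, AverageTendsto P x fun v => ‖a - v‖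

variable {P Q : Measure V} [IsProbabilityMeasure P] [IsProbabilityMeasure Q]

theorem integrable_simpleApprox (k : ℕ) : Integrable (simpleApprox V k) P :=
  SimpleFunc.integrable_of_isFiniteMeasure _

theorem tendsto_integral_norm_sub_simpleApprox (hP : Integrable (fun x => x) P) :
    Tendsto (fun k => ∫ v, ‖v - simpleApprox V k v‖ ∂P) atTop (𝓝 0) := by
  have h := SimpleFunc.tendsto_approxOn_L1_enorm (μ := P) (f := id) measurable_id
    (Set.mem_univ (0 : V)) (by simp) (by simpa using! hP.2)
  have h2 : ∀ k, ∫ v, ‖v - simpleApprox V k v‖ ∂P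
      = (∫⁻ v, ‖simpleApprox V k v - id v‖ₑ ∂P).toReal := by
    intro k
    simp_rw [enorm_sub_rev (simpleApprox V k _)]
    exact integral_norm_eq_lintegral_enorm (hP.sub (integrable_simpleApprox k)).1
  simp_rw [h2]
  exact (ENNReal.tendsto_toReal ENNReal.zero_ne_top).comp h

theorem IsIID.ae_isTypical {Ω : Type*} [MeasurableSpace Ω] {μ : Measure Ω} {X : ℕ → Ω → V}
    (hX : IsIID μ P X) (hP : Integrable (fun x => x) P) :
    ∀ᵐ ω ∂μ, IsTypical P (fun i => X i ω) := by
  have h1 : ∀ᵐ ω ∂μ, ∀ k, AverageTendsto P (fun i => X i ω)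
      fun v => ‖v - simpleApprox V k v‖ :=
    ae_all_iff.2 fun k => hX.ae_averageTendsto
      (measurable_id.sub (simpleApprox V k).measurable).norm
      (hP.sub (integrable_simpleApprox k)).norm
  have h2 : ∀ᵐ ω ∂μ, ∀ k, ∀ a ∈ (simpleApprox V k).range, AverageTendsto P (fun i => X i ω)
      ((simpleApprox V k ⁻¹' {a}).indicator fun _ => (1 : ℝ)) :=
    ae_all_iff.2 fun k => (Finset.eventually_all _).2 fun a _ => hX.ae_averageTendsto
      (measurable_const.indicator ((simpleApprox V k).measurableSet_fiber a))
      ((integrable_const _).indicator ((simpleApprox V k).measurableSet_fiber a))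
  have h3 : ∀ᵐ ω ∂μ, ∀ k, ∀ a ∈ (simpleApprox V k).range, AverageTendsto P (fun i => X i ω)
      fun v => ‖a - v‖ :=
    ae_all_iff.2 fun k => (Finset.eventually_all _).2 fun a _ => hX.ae_averageTendsto
      (measurable_const.sub measurable_id).norm ((integrable_const a).sub hP).norm
  filter_upwards [h1, h2, h3] with ω a b c using ⟨a, b, c⟩

theorem norm_simpleApprox_sub_eq_sum (k : ℕ) (u v : V) :
    ‖simpleApprox V k u - v‖ = ∑ a ∈ (simpleApprox V k).range,
      (simpleApprox V k ⁻¹' {a}).indicator (fun _ => (1 : ℝ)) u * ‖a - v‖ := by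
  rw [Finset.sum_eq_single (simpleApprox V k u)]
  · simp
  · intro b _ hb
    rw [Set.indicator_of_notMem (by simpa using hb.symm), zero_mul]
  · intro h
    exact absurd (SimpleFunc.mem_range_self _ u) h

theorem integral_norm_simpleApprox_sub (hQ : Integrable (fun x => x) Q) (k : ℕ) :
    ∫ z, ‖simpleApprox V k z.1 - z.2‖ ∂(P.prod Q)
      = ∑ a ∈ (simpleApprox V k).range,
        (∫ u, (simpleApprox V k ⁻¹' {a}).indicator (fun _ => (1 : ℝ)) u ∂P)
          * ∫ v, ‖a - v‖ ∂Q := by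
  simp_rw [norm_simpleApprox_sub_eq_sum]
  rw [integral_finsetSum]
  · exact Finset.sum_congr rfl fun a _ => integral_prod_mul
      ((simpleApprox V k ⁻¹' {a}).indicator fun _ => (1 : ℝ)) fun v => ‖a - v‖
  · intro a _
    exact Integrable.mul_prod
      ((integrable_const (1 : ℝ)).indicator ((simpleApprox V k).measurableSet_fiber a))
      ((integrable_const a).sub hQ).norm

theorem meanDist_simpleApprox (x y : ℕ → V) (k n m : ℕ) :
    meanDist (fun i => simpleApprox V k (x i)) y n m
      = ∑ a ∈ (simpleApprox V k).range,
        ((n : ℝ)⁻¹ * ∑ i ∈ Finset.range n,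
            (simpleApprox V k ⁻¹' {a}).indicator (fun _ => (1 : ℝ)) (x i))
          * ((m : ℝ)⁻¹ * ∑ j ∈ Finset.range m, ‖a - y j‖) := by
  simp_rw [meanDist, norm_simpleApprox_sub_eq_sum]
  rw [Finset.sum_congr rfl fun i _ => Finset.sum_comm, Finset.sum_comm, Finset.mul_sum,
    Finset.mul_sum]
  refine Finset.sum_congr rfl fun a _ => ?_
  rw [mul_mul_mul_comm, Finset.sum_mul_sum, mul_assoc]

theorem IsTypical.tendsto_meanDist {x y : ℕ → V} (hx : IsTypical P x) (hy : IsTypical Q y)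
    (hP : Integrable (fun x => x) P) (hQ : Integrable (fun x => x) Q)
    {m : ℕ → ℕ} (hm : Tendsto m atTop atTop) :
    Tendsto (fun n => meanDist x y n (m n)) atTop (𝓝 (∫ z, ‖z.1 - z.2‖ ∂(P.prod Q))) := by
  rw [Metric.tendsto_atTop']
  intro ε hε
  obtain ⟨k, hk⟩ := ((tendsto_integral_norm_sub_simpleApprox hP).eventually
    (gt_mem_nhds (show (0 : ℝ) < ε / 4 by positivity))).exists
  have hT : Tendsto (fun n => meanDist (fun i => simpleApprox V k (x i)) y n (m n)) atTop
      (𝓝 (∫ z, ‖simpleApprox V k z.1 - z.2‖ ∂(P.prod Q))) := by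
    rw [integral_norm_simpleApprox_sub hQ]
    simp_rw [meanDist_simpleApprox]
    exact tendsto_finsetSum _ fun a ha => (hx.freq k a ha).mul ((hy.dist k a ha).comp hm)
  have hlim : |∫ z, ‖z.1 - z.2‖ ∂(P.prod Q) - ∫ z, ‖simpleApprox V k z.1 - z.2‖ ∂(P.prod Q)|
      ≤ ∫ v, ‖v - simpleApprox V k v‖ ∂P := by
    have i1 := integrable_norm_sub_prod hP hQ
    have i2 : Integrable (fun z : V × V => ‖simpleApprox V k z.1 - z.2‖) (P.prod Q) :=
      (((integrable_simpleApprox k).comp_fst Q).sub (hQ.comp_snd P)).norm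
    have i3 : Integrable (fun z : V × V => ‖z.1 - simpleApprox V k z.1‖) (P.prod Q) :=
      ((hP.sub (integrable_simpleApprox k)).norm).comp_fst Q
    have e : ∫ v, ‖v - simpleApprox V k v‖ ∂P
        = ∫ z, ‖z.1 - simpleApprox V k z.1‖ ∂(P.prod Q) := by
      rw [integral_fun_fst (fun v => ‖v - simpleApprox V k v‖)]
      simp
    rw [e, ← integral_sub i1 i2]
    refine (abs_integral_le_integral_abs).trans (integral_mono (i1.sub i2).abs i3 fun z => ?_)
    exact (abs_norm_sub_norm_le _ _).trans (by simp)
  obtain ⟨N, hN⟩ := eventually_atTop.1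
    (((hx.approx k).eventually (gt_mem_nhds hk)).and
      (Metric.tendsto_nhds.1 hT (ε / 4) (by positivity)))
  refine ⟨N, fun n hn => ?_⟩
  obtain ⟨h1, h2⟩ := hN n hn.le
  have h3 := abs_meanDist_sub_le x (fun i => simpleApprox V k (x i)) y n (m n)
  rw [Real.dist_eq] at h2 ⊢
  have h4 := abs_lt.1 h2
  have h5 := abs_le.1 h3
  have h6 := abs_le.1 hlim
  rw [abs_lt]
  constructor <;> linarith

end Averages

theorem vStat_sample_eq_meanDist {d : ℕ} (x y : ℕ → EuclideanSpace ℝ (Fin d)) (n m : ℕ) :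
    vStat delta1 (sample x n) (sample y m)
      = 2 * meanDist x y n m - meanDist x x n n - meanDist y y m m := by
  simp only [vStat, meanDist, sample, delta1, Finset.sum_range]
  ring

theorem IsTypical.tendsto_vStat {d : ℕ} {P Q : Measure (EuclideanSpace ℝ (Fin d))}
    [IsProbabilityMeasure P] [IsProbabilityMeasure Q] {x y : ℕ → EuclideanSpace ℝ (Fin d)}
    (hx : IsTypical P x) (hy : IsTypical Q y)
    (hP : Integrable (fun x => x) P) (hQ : Integrable (fun x => x) Q)
    {m : ℕ → ℕ} (hm : Tendsto m atTop atTop) :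
    Tendsto (fun n => vStat delta1 (sample x n) (sample y (m n))) atTop
      (𝓝 (energyDist P Q)) := by
  simp_rw [vStat_sample_eq_meanDist]
  exact (((hx.tendsto_meanDist hy hP hQ hm).const_mul 2).sub
    (hx.tendsto_meanDist hx hP hP tendsto_id)).sub
    ((hy.tendsto_meanDist hy hQ hQ tendsto_id).comp hm)

theorem pi_withDensity_ofReal {ι α : Type*} [Fintype ι] [MeasurableSpace α] {ν : Measure α}
    [SigmaFinite ν] {g : α → ℝ} (hg : Integrable g ν) :
    Measure.pi (fun _ : ι => ν.withDensity fun x => ENNReal.ofReal (g x))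
      = (Measure.pi fun _ => ν).withDensity fun y => ∏ i, ENNReal.ofReal (g (y i)) := by
  have := isFiniteMeasure_withDensity_ofReal hg.2
  refine Measure.pi_eq fun s hs => ?_
  have hint : ∀ i, Integrable (fun x => max (g x) 0) (ν.restrict (s i)) :=
    fun i => hg.pos_part.restrict
  have hcoe : ∀ r : ℝ, ENNReal.ofReal r = ENNReal.ofReal (max r 0) := fun r => by simp
  rw [withDensity_apply _ (MeasurableSet.univ_pi hs), Measure.restrict_pi_pi]
  have h1 : ∀ y : ι → α, ∏ i, ENNReal.ofReal (g (y i))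
      = ENNReal.ofReal (∏ i, max (g (y i)) 0) := fun y => by
    rw [ENNReal.ofReal_prod_of_nonneg fun i _ => le_max_right _ _]
    exact Finset.prod_congr rfl fun i _ => hcoe _
  have h2 : ∀ i, (ν.withDensity fun x => ENNReal.ofReal (g x)) (s i)
      = ENNReal.ofReal (∫ x in s i, max (g x) 0 ∂ν) := fun i => by
    rw [withDensity_apply _ (hs i), ofReal_integral_eq_lintegral_ofReal (hint i)
      (ae_of_all _ fun x => le_max_right _ _)]
    exact lintegral_congr fun x => hcoe _
  simp_rw [h1, h2]
  rw [← ENNReal.ofReal_prod_of_nonneg fun i _ =>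
      integral_nonneg fun x => le_max_right (g x) 0, ← ofReal_integral_eq_lintegral_ofReal (Integrable.fintype_prod_dep hint)
      (ae_of_all _ fun y => Finset.prod_nonneg fun i _ => le_max_right _ _),
    integral_fintype_prod_eq_prod (fun (_ : ι) (x : α) => max (g x) 0)]

theorem isIID_infinitePi {S : Type*} [MeasurableSpace S] (P : Measure S) [IsProbabilityMeasure P] :
    IsIID (Measure.infinitePi fun _ : ℕ => P) P fun i y => y i where
  measurable i := measurable_pi_apply i
  law i := Measure.infinitePi_map_eval _ i
  indep := iIndepFun_infinitePi (X := fun _ v => v) fun _ => measurable_id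

theorem IsIID.map_sample {Ω S : Type*} [MeasurableSpace Ω] [MeasurableSpace S] {μ : Measure Ω}
    [IsProbabilityMeasure μ] {P : Measure S} {X : ℕ → Ω → S} (hX : IsIID μ P X) (m : ℕ) :
    μ.map (fun ω => sample (fun i => X i ω) m) = Measure.pi fun _ : Fin m => P := by
  have hind : iIndepFun (fun (i : Fin m) => X i) μ := hX.indep.precomp Fin.val_injective
  have h := hind.map_fun_eq_pi_map
    fun i : Fin m => (hX.measurable i).aemeasurable
  simp_rw [hX.law] at h
  exact h

theorem IsWeight.exists_antitone {w : ℝ → ℝ → ℝ} (hw : IsWeight w) {ε : ℝ} (hε : 0 < ε) :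
    ∃ v : ℝ → ℝ, Antitone v ∧ ∀ r, 0 ≤ r → w r ε = v r :=
  ⟨fun r => w (max r 0) ε, fun r s h => hw.antitone ε hε (le_max_right r 0) (le_max_right s 0)
    (max_le_max_right 0 h), fun r hr => by simp [hr]⟩

theorem tendsto_weight_of_mem_contSet {w : ℝ → ℝ → ℝ} {ε r : ℝ} (hr : r ∈ contSet w ε)
    {u : ℕ → ℝ} (hu : Tendsto u atTop (𝓝 r)) (hu0 : ∀ᶠ n in atTop, 0 ≤ u n) :
    Tendsto (fun n => w (u n) ε) atTop (𝓝 (w r ε)) :=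
  hr.2.tendsto.comp (tendsto_nhdsWithin_iff.2 ⟨hu, hu0⟩)

theorem measurable_vStat_delta1 {d n m : ℕ} (x : Fin n → EuclideanSpace ℝ (Fin d)) :
    Measurable fun y : Fin m → EuclideanSpace ℝ (Fin d) => vStat delta1 x y := by
  refine Continuous.measurable ?_
  unfold vStat delta1
  fun_prop

theorem measurable_weight_vStat {d n m : ℕ} (hd : 0 < d) (hn : 0 < n) (hm : 0 < m)
    {w : ℝ → ℝ → ℝ} (hw : IsWeight w) {ε : ℝ} (hε : 0 < ε)
    (x : Fin n → EuclideanSpace ℝ (Fin d)) :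
    Measurable fun y : Fin m → EuclideanSpace ℝ (Fin d) => w (vStat delta1 x y) ε := by
  obtain ⟨v, hv, hwv⟩ := hw.exists_antitone hε
  have : (fun y : Fin m → EuclideanSpace ℝ (Fin d) => w (vStat delta1 x y) ε)
      = fun y => v (vStat delta1 x y) := by
    funext y
    exact hwv _ (vStat_nonneg hd hn hm x y)
  rw [this]
  exact hv.measurable.comp (measurable_vStat_delta1 x)

section Model

variable {d : ℕ} {T : Type*} {𝕏 : Set (EuclideanSpace ℝ (Fin d))}
  {f : EuclideanSpace ℝ (Fin d) → T → ℝ}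

theorem IsPDF.integrable {S : Type*} [MeasurableSpace S] {ν : Measure S} {g : S → ℝ}
    (hg : IsPDF ν g) : Integrable g ν :=
  Integrable.of_integral_ne_zero (by rw [hg.integral_eq_one]; exact one_ne_zero)

theorem isProbabilityMeasure_modelLaw {θ : T}
    (hf : IsPDF (volume.restrict 𝕏) fun x => f x θ) : IsProbabilityMeasure (modelLaw 𝕏 f θ) := by
  refine ⟨?_⟩
  rw [modelLaw, withDensity_apply _ MeasurableSet.univ, Measure.restrict_univ,
    ← ofReal_integral_eq_lintegral_ofReal hf.integrable hf.nonneg, hf.integral_eq_one,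
    ENNReal.ofReal_one]

theorem integrable_id_of_sq_norm {P : Measure (EuclideanSpace ℝ (Fin d))} [IsFiniteMeasure P]
    (h : Integrable (fun x => ‖x‖ ^ 2) P) : Integrable (fun x => x) P := by
  refine ((integrable_const (1 : ℝ)).add h).mono' (by fun_prop) (ae_of_all _ fun x => ?_)
  simp only [Pi.add_apply]
  nlinarith [sq_nonneg (‖x‖ - 1)]

theorem approxLikelihood_eq_integral_pi {θ : T} (hf : IsPDF (volume.restrict 𝕏) fun x => f x θ)
    (w : ℝ → ℝ → ℝ) {n m : ℕ}
    (D : (Fin n → EuclideanSpace ℝ (Fin d)) → (Fin m → EuclideanSpace ℝ (Fin d)) → ℝ)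
    (ε : ℝ) (x : Fin n → EuclideanSpace ℝ (Fin d)) :
    approxLikelihood 𝕏 f w D ε x θ
      = ∫ y, w (D x y) ε ∂(Measure.pi fun _ : Fin m => modelLaw 𝕏 f θ) := by
  have hmeas := hf.measurable
  simp only [modelLaw]
  rw [pi_withDensity_ofReal hf.integrable, approxLikelihood, volume_pi, Measure.restrict_pi_pi]
  have hcoe : (fun y : Fin m → EuclideanSpace ℝ (Fin d) => ∏ i, ENNReal.ofReal (f (y i) θ))
      = fun y => ((∏ i, (f (y i) θ).toNNReal : NNReal) : ENNReal) := by
    funext y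
    push_cast
    rfl
  have hdens : Measurable fun y : Fin m → EuclideanSpace ℝ (Fin d) =>
      ∏ i, (f (y i) θ).toNNReal :=
    Finset.measurable_prod _ fun i _ => (hmeas.comp (measurable_pi_apply i)).real_toNNReal
  rw [hcoe, integral_withDensity_eq_integral_smul hdens]
  refine integral_congr_ae ?_
  have hnn : ∀ᵐ y ∂(Measure.pi fun _ : Fin m => volume.restrict 𝕏), ∀ i, 0 ≤ f (y i) θ :=
    ae_all_iff.2 fun i => (Measure.tendsto_eval_ae_ae
      (μ := fun _ : Fin m => volume.restrict 𝕏) (i := i)).eventually hf.nonneg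
  filter_upwards [hnn] with y hy
  rw [NNReal.smul_def, smul_eq_mul, mul_comm]
  push_cast
  congr 1
  exact Finset.prod_congr rfl fun i _ => (Real.coe_toNNReal _ (hy i)).symm

theorem approxLikelihood_mem_Icc (hd : 0 < d) {θ : T}
    (hf : IsPDF (volume.restrict 𝕏) fun x => f x θ) {w : ℝ → ℝ → ℝ} (hw : IsWeight w) {ε a : ℝ}
    (hε : 0 < ε) (ha : ∀ r, 0 ≤ r → w r ε ≤ a) {n m : ℕ} (hn : 0 < n) (hm : 0 < m)
    (x : Fin n → EuclideanSpace ℝ (Fin d)) :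
    approxLikelihood 𝕏 f w (vStat delta1 (m := m)) ε x θ ∈ Set.Icc 0 a := by
  have := isProbabilityMeasure_modelLaw hf
  have h0 : ∀ y : Fin m → EuclideanSpace ℝ (Fin d), 0 ≤ w (vStat delta1 x y) ε :=
    fun y => hw.nonneg ε hε _ (vStat_nonneg hd hn hm x y)
  have h1 : ∀ y : Fin m → EuclideanSpace ℝ (Fin d), w (vStat delta1 x y) ε ≤ a :=
    fun y => ha _ (vStat_nonneg hd hn hm x y)
  rw [approxLikelihood_eq_integral_pi hf]
  refine ⟨integral_nonneg h0, ?_⟩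
  have hint : Integrable (fun y => w (vStat delta1 x y) ε)
      (Measure.pi fun _ : Fin m => modelLaw 𝕏 f θ) :=
    (integrable_const a).mono' (measurable_weight_vStat hd hn hm hw hε x).aestronglyMeasurable
      (ae_of_all _ fun y => by rw [Real.norm_of_nonneg (h0 y)]; exact h1 y)
  simpa using integral_mono hint (integrable_const a) h1

theorem measurable_approxLikelihood [MeasurableSpace T] (hd : 0 < d)
    (hf : Measurable (Function.uncurry f)) {w : ℝ → ℝ → ℝ} (hw : IsWeight w) {ε : ℝ}
    (hε : 0 < ε) {n m : ℕ} (hn : 0 < n) (hm : 0 < m) (x : Fin n → EuclideanSpace ℝ (Fin d)) :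
    Measurable fun θ => approxLikelihood 𝕏 f w (vStat delta1 (m := m)) ε x θ := by
  have hmeas : Measurable fun p : T × (Fin m → EuclideanSpace ℝ (Fin d)) =>
      w (vStat delta1 x p.2) ε * ∏ i, f (p.2 i) p.1 := by
    refine ((measurable_weight_vStat hd hn hm hw hε x).comp measurable_snd).mul
      (Finset.measurable_prod _ fun i _ => ?_)
    have hi : Measurable fun p : T × (Fin m → EuclideanSpace ℝ (Fin d)) => (p.2 i, p.1) :=
      ((measurable_pi_apply i).comp measurable_snd).prodMk measurable_fst
    exact hf.comp hi
  exact hmeas.stronglyMeasurable.integral_prod_right'.measurable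

theorem tendsto_approxLikelihood (hd : 0 < d) {θ : T}
    (hf : IsPDF (volume.restrict 𝕏) fun x => f x θ)
    (hQ : Integrable (fun x => x) (modelLaw 𝕏 f θ))
    {w : ℝ → ℝ → ℝ} (hw : IsWeight w) {ε : ℝ} (hε : 0 < ε)
    {P : Measure (EuclideanSpace ℝ (Fin d))} [IsProbabilityMeasure P]
    (hP : Integrable (fun x => x) P) {x : ℕ → EuclideanSpace ℝ (Fin d)} (hx : IsTypical P x)
    (hD : energyDist P (modelLaw 𝕏 f θ) ∈ contSet w ε)
    {m : ℕ → ℕ} (hm : Tendsto m atTop atTop) :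
    Tendsto (fun n => approxLikelihood 𝕏 f w (vStat delta1 (n := n) (m := m n)) ε (sample x n) θ)
      atTop (𝓝 (w (energyDist P (modelLaw 𝕏 f θ)) ε)) := by
  have := isProbabilityMeasure_modelLaw hf
  set Q := modelLaw 𝕏 f θ with hQ_def
  set ν : Measure (ℕ → EuclideanSpace ℝ (Fin d)) := Measure.infinitePi fun _ : ℕ => Q
  have hiid : IsIID ν Q fun i y => y i := isIID_infinitePi Q
  obtain ⟨a, ha⟩ := hw.bounded ε hε
  have hev : ∀ᶠ n in atTop, 0 < n ∧ 0 < m n :=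
    (eventually_gt_atTop 0).and (hm.eventually (eventually_gt_atTop 0))
  have hsample : ∀ k, Measurable fun y : ℕ → EuclideanSpace ℝ (Fin d) => sample y k :=
    fun k => measurable_pi_lambda _ fun i => measurable_pi_apply _
  have hlim : Tendsto (fun n => ∫ y, w (vStat delta1 (sample x n) (sample y (m n))) ε ∂ν) atTop
      (𝓝 (∫ _, w (energyDist P Q) ε ∂ν)) := by
    refine tendsto_integral_filter_of_dominated_convergence (fun _ => a) ?_ ?_
      (integrable_const a) ?_
    · filter_upwards [hev] with n hn
      exact ((measurable_weight_vStat hd hn.1 hn.2 hw hε _).comp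
        (hsample (m n))).aestronglyMeasurable
    · filter_upwards [hev] with n hn
      refine ae_of_all _ fun y => ?_
      have h0 := vStat_nonneg hd hn.1 hn.2 (sample x n) (sample y (m n))
      rw [Real.norm_of_nonneg (hw.nonneg ε hε _ h0)]
      exact ha _ h0
    · filter_upwards [hiid.ae_isTypical hQ] with y hy
      refine tendsto_weight_of_mem_contSet hD (hx.tendsto_vStat hy hP hQ hm) ?_
      filter_upwards [hev] with n hn
      exact vStat_nonneg hd hn.1 hn.2 _ _
  rw [integral_const, probReal_univ, one_smul] at hlim
  refine hlim.congr' ?_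
  filter_upwards [hev] with n hn
  rw [approxLikelihood_eq_integral_pi hf, ← hQ_def, ← hiid.map_sample (m n),
    integral_map (hsample (m n)).aemeasurable
      (measurable_weight_vStat hd hn.1 hn.2 hw hε _).aestronglyMeasurable]

theorem dInf_eq_energyDist (hd : 0 < d) {θ₀ θ : T}
    (hf₀ : IsPDF (volume.restrict 𝕏) fun x => f x θ₀)
    (hf : IsPDF (volume.restrict 𝕏) fun x => f x θ)
    (hP : Integrable (fun x => x) (modelLaw 𝕏 f θ₀))
    (hQ : Integrable (fun x => x) (modelLaw 𝕏 f θ)) :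
    Integrable (energyIntegrand 𝕏 f θ₀ θ) ∧
      dInf 𝕏 f θ₀ θ = energyDist (modelLaw 𝕏 f θ₀) (modelLaw 𝕏 f θ) := by
  have : Nonempty (Fin d) := ⟨⟨0, hd⟩⟩
  have := isProbabilityMeasure_modelLaw hf₀
  have := isProbabilityMeasure_modelLaw hf
  have h1 := integrable_sq_norm_charFun_sub_div hP hQ
  have h2 := integral_sq_norm_charFun_sub_div hP hQ
  rw [finrank_euclideanSpace_fin] at h1 h2
  refine ⟨h1, ?_⟩
  unfold dInf energyIntegrand
  rw [h2, energyConst, ← mul_assoc, div_mul_div_comm, mul_comm (Real.pi ^ _), div_self, one_mul]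
  exact mul_ne_zero (Real.Gamma_pos_of_pos (by positivity)).ne' (by positivity)

theorem tendsto_normConst [MeasurableSpace T] {ρ : Measure T} (hd : 0 < d)
    (hf_meas : Measurable (Function.uncurry f))
    (hf : ∀ θ, IsPDF (volume.restrict 𝕏) fun x => f x θ)
    (hmom : ∀ θ, Integrable (fun x => x) (modelLaw 𝕏 f θ))
    {prior : T → ℝ} (hprior : IsPDF ρ prior)
    {w : ℝ → ℝ → ℝ} (hw : IsWeight w) {ε : ℝ} (hε : 0 < ε) {θ₀ : T}
    (hcont : ∀ᵐ θ ∂ρ, 0 < prior θ → dInf 𝕏 f θ₀ θ ∈ contSet w ε)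
    {x : ℕ → EuclideanSpace ℝ (Fin d)} (hx : IsTypical (modelLaw 𝕏 f θ₀) x)
    {m : ℕ → ℕ} (hm : Tendsto m atTop atTop) :
    Tendsto (fun n => normConst ρ prior 𝕏 f w (vStat delta1 (n := n) (m := m n)) ε (sample x n))
      atTop (𝓝 (∫ θ, prior θ * w (dInf 𝕏 f θ₀ θ) ε ∂ρ)) := by
  have := isProbabilityMeasure_modelLaw (hf θ₀)
  obtain ⟨a, ha⟩ := hw.bounded ε hε
  have hev : ∀ᶠ n in atTop, 0 < n ∧ 0 < m n :=
    (eventually_gt_atTop 0).and (hm.eventually (eventually_gt_atTop 0))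
  refine tendsto_integral_filter_of_dominated_convergence (fun θ => ‖prior θ‖ * a) ?_ ?_
    (hprior.integrable.norm.mul_const a) ?_
  · filter_upwards [hev] with n hn
    exact (hprior.measurable.mul
      (measurable_approxLikelihood hd hf_meas hw hε hn.1 hn.2 _)).aestronglyMeasurable
  · filter_upwards [hev] with n hn
    refine ae_of_all _ fun θ => ?_
    have h := approxLikelihood_mem_Icc hd (hf θ) hw hε ha hn.1 hn.2 (sample x n)
    rw [norm_mul, Real.norm_of_nonneg h.1]
    exact mul_le_mul_of_nonneg_left h.2 (norm_nonneg _)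
  · filter_upwards [hcont, hprior.nonneg] with θ hθ hθ0
    rcases hθ0.eq_or_lt with h0 | h0
    · have h0 : prior θ = 0 := h0.symm
      simp [h0]
    · have h := hθ h0
      rw [(dInf_eq_energyDist hd (hf θ₀) (hf θ) (hmom θ₀) (hmom θ)).2] at h ⊢
      exact (tendsto_approxLikelihood hd (hf θ) (hmom θ) hw hε (hmom θ₀) hx h hm).const_mul _

end Model

end ABC

end

theorem mainTheorem2
    {d : ℕ} (hd : 0 < d)
    {T : Type*} [MeasurableSpace T] (ρ : Measure T)
    {Ω : Type*} [MeasurableSpace Ω] (μ : Measure Ω) [IsProbabilityMeasure μ]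
    (𝕏 : Set (EuclideanSpace ℝ (Fin d))) (h𝕏 : MeasurableSet 𝕏)
    -- the parametric family of PDFs, and its second moments
    (f : EuclideanSpace ℝ (Fin d) → T → ℝ)
    (hf_meas : Measurable (Function.uncurry f))
    (hf : ∀ θ, ABC.IsPDF (volume.restrict 𝕏) (fun x => f x θ))
    (hmom : ∀ θ, Integrable (fun x => ‖x‖ ^ 2) (ABC.modelLaw 𝕏 f θ))
    -- the prior PDF and the weight function
    (prior : T → ℝ) (hprior : ABC.IsPDF ρ prior)
    (w : ℝ → ℝ → ℝ) (hw : ABC.IsWeight w)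
    -- the observed data
    (θ₀ : T) (X : ℕ → Ω → EuclideanSpace ℝ (Fin d))
    (hX : ABC.IsIID μ (ABC.modelLaw 𝕏 f θ₀) X)
    -- the size of the simulated sample
    (m : ℕ → ℕ) (hm : Tendsto m atTop atTop) :
    -- the discrepancy converges almost surely to the limiting discrepancy
    (∀ (θ : T) (Y : ℕ → Ω → EuclideanSpace ℝ (Fin d)),
      ABC.IsIID μ (ABC.modelLaw 𝕏 f θ) Y →
      IndepFun (fun ω i => X i ω) (fun ω i => Y i ω) μ →
      ∀ᵐ ω ∂μ, Tendsto
        (fun n => ABC.vStat ABC.delta1 (ABC.sample (fun i => X i ω) n)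
          (ABC.sample (fun i => Y i ω) (m n)))
        atTop (𝓝 (ABC.dInf 𝕏 f θ₀ θ))) ∧
    -- the pseudo-posterior PDF converges almost surely
    (∀ ε : ℝ, 0 < ε →
      (∀ᵐ θ ∂ρ, 0 < prior θ → ABC.dInf 𝕏 f θ₀ θ ∈ ABC.contSet w ε) →
      0 < ∫ θ, prior θ * w (ABC.dInf 𝕏 f θ₀ θ) ε ∂ρ →
      ∀ θ : T, ABC.dInf 𝕏 f θ₀ θ ∈ ABC.contSet w ε →
        ∀ᵐ ω ∂μ, Tendsto
          (fun n => ABC.pseudoPosterior ρ prior 𝕏 f w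
            (ABC.vStat ABC.delta1 (n := n) (m := m n)) ε (ABC.sample (fun i => X i ω) n) θ)
          atTop
          (𝓝 (prior θ * w (ABC.dInf 𝕏 f θ₀ θ) ε
            / ∫ θ', prior θ' * w (ABC.dInf 𝕏 f θ₀ θ') ε ∂ρ))) ∧
    -- the limiting discrepancy is a convergent integral, non-negative, and separates distributions
    (∀ θ : T, Integrable (ABC.energyIntegrand 𝕏 f θ₀ θ) volume ∧
      0 ≤ ABC.dInf 𝕏 f θ₀ θ ∧
      (ABC.dInf 𝕏 f θ₀ θ = 0 ↔ ABC.modelLaw 𝕏 f θ = ABC.modelLaw 𝕏 f θ₀)) ∧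
    -- if the parameter value `θ₀` is identifiable, it is the only zero
    ((∀ θ : T, ABC.modelLaw 𝕏 f θ = ABC.modelLaw 𝕏 f θ₀ → θ = θ₀) →
      ∀ θ : T, ABC.dInf 𝕏 f θ₀ θ = 0 ↔ θ = θ₀) := by
  have hprob : ∀ θ, IsProbabilityMeasure (ABC.modelLaw 𝕏 f θ) :=
    fun θ => ABC.isProbabilityMeasure_modelLaw (hf θ)
  have hint : ∀ θ, Integrable (fun x => x) (ABC.modelLaw 𝕏 f θ) :=
    fun θ => ABC.integrable_id_of_sq_norm (hmom θ)
  have hdInf := fun θ => ABC.dInf_eq_energyDist hd (hf θ₀) (hf θ) (hint θ₀) (hint θ)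
  have : Nonempty (Fin d) := ⟨⟨0, hd⟩⟩
  have hzero : ∀ θ, ABC.dInf 𝕏 f θ₀ θ = 0 ↔ ABC.modelLaw 𝕏 f θ = ABC.modelLaw 𝕏 f θ₀ := fun θ => by
    rw [(hdInf θ).2, ABC.energyDist_eq_zero_iff (hint θ₀) (hint θ), eq_comm]
  refine ⟨fun θ Y hY _ => ?_, fun ε hε hcont hpos θ hθ => ?_, fun θ => ⟨(hdInf θ).1, ?_, hzero θ⟩,
    fun hid θ => ⟨fun h => hid θ ((hzero θ).1 h), fun h => by rw [hzero, h]⟩⟩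
  · rw [(hdInf θ).2]
    filter_upwards [hX.ae_isTypical (hint θ₀), hY.ae_isTypical (hint θ)] with ω hx hy
    exact hx.tendsto_vStat hy (hint θ₀) (hint θ) hm
  · filter_upwards [hX.ae_isTypical (hint θ₀)] with ω hx
    refine Tendsto.div ?_
      (ABC.tendsto_normConst hd hf_meas hf hint hprior hw hε hcont hx hm) hpos.ne'
    rw [(hdInf θ).2] at hθ ⊢
    exact (ABC.tendsto_approxLikelihood hd (hf θ) (hint θ) hw hε (hint θ₀) hx hθ hm).const_mul _
  · rw [(hdInf θ).2]
    exact ABC.energyDist_nonneg (hint θ₀) (hint θ)
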